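/- Let $d\ge 4$, let $Q\in\mathbb{R}^{d\times d}$ be symmetric positive definite with eigenvalue decomposition $Q=U\Lambda U^T$, $U$ orthogonal, $\Lambda=\mathrm{diag}(\lambda_1,\dots,\lambda_d)$, and $\mu=\lambda_1\le\lambda_2\le\dots\le\lambda_d=L$. Let $f(x)=\frac12x^TQx+p^Tx+r$ with $p\in\mathbb{R}^d$, $r\in\mathbb{R}$, so that $f$ is $\mu$-strongly convex with $L$-Lipschitz gradient. For parameters $\alpha>0$, $\beta\ge0$, $\nu\ge0$ put $$A_Q=\begin{bmatrix}(1+\beta)I_d-\alpha(1+\nu)Q & -\beta I_d+\alpha\nu Q\\ I_d & 0_d\end{bmatrix},\quad B=\begin{bmatrix}-\alpha I_d\\ 0_d\end{bmatrix},\quad T=\Big[\tfrac1{\sqrt2}\Lambda^{1/2}U^T\;\; 0_d\Big],$$ the system matrices of the generalized momentum method $x_{k+1}=x_k-\alpha(\nabla f(y_k)+w_k)+\beta(x_k-x_{k-1})$, $y_k=x_k+\nu(x_k-x_{k-1})$, with gradient errors $w_k$ and output of squared norm $f(x_k)-f(x_*)$, where $x_*$ is the minimizer of $f$. Let $\rho(\cdot)$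 denote the spectral radius and $\|\cdot\|$ the spectral norm of a matrix, and define, for $\mathbb{K}\in\{\mathbb{R},\mathbb{C}\}$, $$r_{\mathbb{K}}(A_Q,B,T)=\inf\Big\{\varepsilon>0:\ \sup_{\Delta\in\mathbb{K}^{d\times d},\,\|\Delta\|\le\varepsilon}\rho(A_Q+B\Delta T)\ge1\Big\},\qquad H_\infty=\max_{z\in\mathbb{C},\,|z|=1}\big\|T(zI_{2d}-A_Q)^{-1}B\big\|,$$ and, with $b_\lambda=\alpha\lambda(1+\nu)-(1+\beta)$ and $c_\lambda=\beta-\alpha\lambda\nu$, $$H_\infty^{\mathrm{lb}}=\frac{\alpha}{\sqrt2}\max_{\omega\in[0,2\pi]}\min\bigg(\max_{\lambda\in\{\lambda_2,L\}}\frac{\sqrt\lambda}{|e^{2i\omega}+b_\lambda e^{i\omega}+c_\lambda|},\ \max_{\lambda\in\{\mu,\lambda_{d-1}\}}\frac{\sqrt\lambda}{|e^{2i\omega}+b_\lambda e^{i\omega}+c_\lambda|}\bigg).$$ Assume that $\rho(A_Q)<1$, $\lambda_2=\mu$ and $\lambda_{d-1}=L$. Then the maxima defining $H_\infty$ and $H_\infty^{\mathrm{lb}}$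 are attained and positive, and $$r_{\mathbb{R}}(A_Q,B,T)=r_{\mathbb{C}}(A_Q,B,T)=\big(H_\infty^{\mathrm{lb}}\big)^{-1}=H_\infty^{-1}.$$ -/

import Mathlib

open scoped Matrix ENNReal Matrix.Norms.L2Operator

namespace GMM

noncomputable section

/-- The class of functions on `ℝ^d` that are `μ`-strongly convex (with `μ > 0`) and `L`-smooth. -/
def IsStronglyConvexSmooth {d : ℕ} (μ L : ℝ) (f : EuclideanSpace ℝ (Fin d) → ℝ) : Prop :=
  0 < μ ∧ ConvexOn ℝ Set.univ (fun x => f x - 1 / 2 * μ * ‖x‖ ^ 2) ∧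
    ContDiff ℝ 1 f ∧ ∀ x y, ‖gradient f x - gradient f y‖ ≤ L * ‖x - y‖

/-- The quadratic `x ↦ (1/2) xᵀ Q x + pᵀ x + r`. -/
def quadratic {d : ℕ} (Q : Matrix (Fin d) (Fin d) ℝ) (p : Fin d → ℝ) (r : ℝ) :
    EuclideanSpace ℝ (Fin d) → ℝ :=
  fun x => 1 / 2 * (x.ofLp ⬝ᵥ Q *ᵥ x.ofLp) + p ⬝ᵥ x.ofLp + r

/-- The state matrix `A_Q`, a `2d × 2d` matrix in `d × d` blocks. -/
def stateMatrix {d : ℕ} (α β ν : ℝ) (Q : Matrix (Fin d) (Fin d) ℝ) :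
    Matrix (Fin d ⊕ Fin d) (Fin d ⊕ Fin d) ℝ :=
  Matrix.fromBlocks ((1 + β) • (1 : Matrix (Fin d) (Fin d) ℝ) - (α * (1 + ν)) • Q)
    (-(β • (1 : Matrix (Fin d) (Fin d) ℝ)) + (α * ν) • Q) 1 0

/-- The input matrix `B = [-α, 0]ᵀ ⊗ I_d`. -/
def inputMatrix (d : ℕ) (α : ℝ) : Matrix (Fin d ⊕ Fin d) (Fin d) ℝ :=
  Matrix.fromRows (-(α • (1 : Matrix (Fin d) (Fin d) ℝ))) 0

/-- The output matrix `T = [ (1/√2) Λ^{1/2} Uᵀ , 0_d ]` with `Λ = diag(lam)`. -/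
def outputMatrix {d : ℕ} (U : Matrix (Fin d) (Fin d) ℝ) (lam : Fin d → ℝ) :
    Matrix (Fin d) (Fin d ⊕ Fin d) ℝ :=
  Matrix.fromCols ((1 / √2) • (Matrix.diagonal (fun i => √(lam i)) * Uᵀ)) 0

section System

variable {m n : Type*} [Fintype m] [DecidableEq m] [Fintype n] [DecidableEq n]

/-- A real matrix viewed as a complex matrix. -/
def toC {k l : Type*} (M : Matrix k l ℝ) : Matrix k l ℂ := M.map Complex.ofReal

/-- The spectral radius (largest modulus of a complex eigenvalue) of a complex square matrix. -/
def specRadius (M : Matrix m m ℂ) : ℝ≥0∞ := spectralRadius ℂ M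

/-- The largest spectral radius of `A + B Δ T` over complex `Δ` of spectral norm at most `ε`. -/
def rhoComplex (A : Matrix m m ℝ) (B : Matrix m n ℝ) (T : Matrix n m ℝ) (ε : ℝ) : ℝ≥0∞ :=
  ⨆ Δ : {Δ : Matrix n n ℂ // ‖Δ‖ ≤ ε}, specRadius (toC A + toC B * Δ.1 * toC T)

/-- The largest spectral radius of `A + B Δ T` over real `Δ` of spectral norm at most `ε`. -/
def rhoReal (A : Matrix m m ℝ) (B : Matrix m n ℝ) (T : Matrix n m ℝ) (ε : ℝ) : ℝ≥0∞ :=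
  ⨆ Δ : {Δ : Matrix n n ℝ // ‖Δ‖ ≤ ε}, specRadius (toC (A + B * Δ.1 * T))

/-- The complex stability radius of the system `(A, B, T)`. -/
def complexStabilityRadius (A : Matrix m m ℝ) (B : Matrix m n ℝ) (T : Matrix n m ℝ) : ℝ :=
  sInf {ε : ℝ | 0 < ε ∧ 1 ≤ rhoComplex A B T ε}

/-- The real stability radius of the system `(A, B, T)`. -/
def realStabilityRadius (A : Matrix m m ℝ) (B : Matrix m n ℝ) (T : Matrix n m ℝ) : ℝ :=
  sInf {ε : ℝ | 0 < ε ∧ 1 ≤ rhoReal A B T ε}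

/-- The transfer matrix `G(z) = T (z I - A)⁻¹ B`. -/
def transferMatrix (A : Matrix m m ℝ) (B : Matrix m n ℝ) (T : Matrix n m ℝ) (z : ℂ) :
    Matrix n n ℂ :=
  toC T * (z • (1 : Matrix m m ℂ) - toC A)⁻¹ * toC B

/-- The `H∞` norm: the maximum over the unit circle of the spectral norm of `G(z)`. -/
def hInf (A : Matrix m m ℝ) (B : Matrix m n ℝ) (T : Matrix n m ℝ) : ℝ :=
  sSup ((fun z : ℂ => ‖transferMatrix A B T z‖) '' Metric.sphere 0 1)

end System

/-- `b_λ = α λ (1 + ν) - (1 + β)`. -/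
def bCoef (α β ν l : ℝ) : ℝ := α * l * (1 + ν) - (1 + β)

/-- `c_λ = β - α λ ν`. -/
def cCoef (α β ν l : ℝ) : ℝ := β - α * l * ν

/-- `√λ / |e^{2iω} + b_λ e^{iω} + c_λ|`. -/
def gainTerm (α β ν ω l : ℝ) : ℝ :=
  √l / ‖Complex.exp (2 * Complex.I * ω) + bCoef α β ν l * Complex.exp (Complex.I * ω)
    + cCoef α β ν l‖

/-- The function of `ω` maximized in the lower bound for the `H∞` norm; `l₁, l₂` are the two
smallest and `l₃, l₄` the two largest eigenvalues, in increasing order. -/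
def lowerBoundFun (α β ν l₁ l₂ l₃ l₄ ω : ℝ) : ℝ :=
  min (max (gainTerm α β ν ω l₂) (gainTerm α β ν ω l₄))
    (max (gainTerm α β ν ω l₁) (gainTerm α β ν ω l₃))

/-- The lower bound `H∞^{lb}`. -/
def hInfLB (α β ν l₁ l₂ l₃ l₄ : ℝ) : ℝ :=
  α / √2 * sSup (lowerBoundFun α β ν l₁ l₂ l₃ l₄ '' Set.Icc 0 (2 * Real.pi))

end

end GMM

/-! In the eigenbasis of `Q` the system decouples: up to a unitary factor the transfer matrix is
diagonal, with entries of modulus `(α/√2) √λ / |p_λ(z)|` on the unit circle, where `p_λ(z) = z² +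
b_λ z + c_λ`. So `H∞` is the largest such gain over the circle and the spectrum.

The crux is that the worst gain over `λ ∈ [μ, L]` occurs at `μ` or `L`. With `x = Re z` and `u =
αλ`, `|p_λ(z)|²` is a cubic polynomial `F(x, u)`. If `F/u` had its minimum over the rectangle
strictly below its values on the two edges `u = αμ` and `u = αL`, stability would exclude the edges
`x = ±1`, and at the resulting interior critical point the Hessian of `F - s u`, with `s` the
minimum, is indefinite (`hessian_indefinite`, `le_sqModulus_of_endpoints`). Since `λ₂ = μ` and
`λ_{d-1} = L`, the two arguments of the `min` in `H∞^{lb}` agree, and `H∞^{lb} = H∞`.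

For the radii, the maximum modulus principle carries the gain bound to `|z| ≥ 1`, so complex
perturbations of norm below `1/H∞` leave no eigenvalue there (`rhoComplex_lt_one`). Conversely, the
critical eigenvalue is double: its real eigenplane contains the complex vector `e_j - i e_k`, on
which a real rotation-scaling acts as any prescribed complex number. Hence a real perturbation of
norm at most `1/H∞` already destabilises (`one_le_rhoReal`). -/

namespace GMM

/-! ### The two-variable inequality: extreme gains occur at extreme eigenvalues. -/

/-- The value of `|z² + b z + c|²` at a point `z` of the unit circle with real part `x`, where
`c = β - ν u` and `b = u - 1 - c`. -/
def sqModulus (β ν x u : ℝ) : ℝ :=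
  (1 - (β - ν * u)) ^ 2 + (u - 1 - (β - ν * u)) ^ 2
    + 2 * (u - 1 - (β - ν * u)) * (1 + (β - ν * u)) * x + 4 * (β - ν * u) * x ^ 2

/-- First and second order conditions at a minimum in one stroke: `sqModulus - s u` restricted to a
line through its zero minimum is exactly such a cubic. -/
lemma nonneg_cubic_coeff {δ c₁ c₂ c₃ : ℝ} (hδ : 0 < δ)
    (h : ∀ t : ℝ, |t| < δ → 0 ≤ c₁ * t + c₂ * t ^ 2 + c₃ * t ^ 3) :
    c₁ = 0 ∧ 0 ≤ c₂ := by
  have hd : HasDerivAt (fun t : ℝ => c₁ * t + c₂ * t ^ 2 + c₃ * t ^ 3) c₁ 0 := by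
    have := (((hasDerivAt_id (0 : ℝ)).const_mul c₁).add
      (((hasDerivAt_id (0 : ℝ)).pow 2).const_mul c₂)).add
      (((hasDerivAt_id (0 : ℝ)).pow 3).const_mul c₃)
    exact (this.congr_deriv (by simp)).congr_of_eventuallyEq (.of_forall fun t => by simp)
  have hmin : IsLocalMin (fun t : ℝ => c₁ * t + c₂ * t ^ 2 + c₃ * t ^ 3) 0 := by
    filter_upwards [Metric.ball_mem_nhds (0 : ℝ) hδ] with t ht
    simpa using h t (by simpa using ht)
  have h₁ : c₁ = 0 := hmin.hasDerivAt_eq_zero hd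
  refine ⟨h₁, ?_⟩
  subst h₁
  have hlim : Filter.Tendsto (fun t : ℝ => c₂ + c₃ * t) (nhdsWithin 0 (Set.Ioi 0))
      (nhds c₂) := by
    have : Continuous fun t : ℝ => c₂ + c₃ * t := by fun_prop
    simpa using (this.tendsto 0).mono_left nhdsWithin_le_nhds
  refine ge_of_tendsto hlim ?_
  filter_upwards [Ioo_mem_nhdsGT hδ] with t ht
  have h2 := h t (by rw [abs_of_pos ht.1]; exact ht.2)
  have h3 : 0 < t ^ 2 := by have := ht.1; positivity
  refine nonneg_of_mul_nonneg_right (?_ : 0 ≤ t ^ 2 * _) h3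
  linarith

/-- Positivity of the polynomial that is the discriminant of the Hessian at a critical point. -/
lemma discriminant_poly_pos {a c u : ℝ} (ha : 0 < a) (hc : 0 < c) (hac : a + c = 1)
    (h₁ : a ≤ u) (h₂ : u < a + 4 * c) :
    0 < u ^ 2 * (u * (1 + c) - a ^ 2) ^ 2 * (4 * c + a - u) ^ 2
      + 2 * u * (u ^ 2 - a ^ 2) * (u * (1 + c) - a ^ 2) * (4 * c + a - u)
        * (u * (1 + c) - a - 2 * (1 + c) * c)
      + (u ^ 2 - a ^ 2) ^ 2 * ((u - a * (1 + c)) ^ 2 - 2 * c ^ 2 * (u * (1 + c) - a ^ 2)) := by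
  -- Put `u` at the fraction `θ ∈ [0, 1)` of its interval. Homogenised by `θ + w = 1` and `a + c =
  -- 1`, the polynomial has only nonnegative coefficients, which makes its sign evident.
  obtain ⟨θ, hθ⟩ : ∃ θ, u = a + 4 * c * θ := ⟨(u - a) / (4 * c), by field_simp; ring⟩
  have hθ0 : 0 ≤ θ := by
    by_contra! h
    nlinarith [mul_neg_of_pos_of_neg hc h]
  obtain ⟨w, hw⟩ : ∃ w, w = 1 - θ := ⟨_, rfl⟩
  have hw0 : 0 < w := by
    have : 0 < c * w := by rw [hw]; linarith
    exact pos_of_mul_pos_right this hc.le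
  have key : 0 < c ^ 4 * (a ^ 4 * (64 * w ^ 6 + 384 * θ * w ^ 5 + 1216 * θ ^ 2 * w ^ 4
        + 2304 * θ ^ 3 * w ^ 3 + 2752 * θ ^ 4 * w ^ 2 + 1920 * θ ^ 5 * w + 576 * θ ^ 6)
      + a ^ 3 * c * (512 * θ * w ^ 5 + 2560 * θ ^ 2 * w ^ 4 + 8192 * θ ^ 3 * w ^ 3
        + 13824 * θ ^ 4 * w ^ 2 + 10752 * θ ^ 5 * w + 3072 * θ ^ 6)
      + a ^ 2 * c ^ 2 * (1024 * θ ^ 2 * w ^ 4 + 7168 * θ ^ 3 * w ^ 3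
        + 24832 * θ ^ 4 * w ^ 2 + 24064 * θ ^ 5 * w + 5376 * θ ^ 6)
      + a * c ^ 3 * (15360 * θ ^ 4 * w ^ 2 + 26624 * θ ^ 5 * w + 3072 * θ ^ 6)
      + c ^ 4 * (12288 * θ ^ 5 * w)) := by positivity
  convert key using 1
  subst hθ hw
  obtain rfl : a = 1 - c := by linarith
  ring

/-- At a critical point of `u ↦ sqModulus β ν x u / u` in the interior, the Hessian is
indefinite. -/
lemma hessian_indefinite {ν x u c : ℝ} (hν : 0 ≤ ν) (hx : x < 1) (hu : 0 < u) (hc : 0 < c)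
    (hc1 : c < 1) (hx' : 2 * (u - 1 - c) * (1 + c) + 8 * c * x = 0)
    (hu' : u * (2 * ν * (1 - c) + 2 * (u - 1 - c) * (1 + ν)
        + 2 * x * ((1 + ν) * (1 + c) - ν * (u - 1 - c)) - 4 * ν * x ^ 2)
      = (1 - c) ^ 2 + (u - 1 - c) ^ 2 + 2 * (u - 1 - c) * (1 + c) * x + 4 * c * x ^ 2) :
    16 * c * (ν ^ 2 + (1 + ν) ^ 2 - 2 * ν * (1 + ν) * x)
      < (2 * ((1 + ν) * (1 + c) - ν * (u - 1 - c)) - 8 * ν * x) ^ 2 := by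
  obtain ⟨a, ha⟩ : ∃ a, a = 1 - c := ⟨_, rfl⟩
  have ha0 : 0 < a := by linarith
  have hxe : x = -((u - 1 - c) * (1 + c)) / (4 * c) := by field_simp; linarith
  have hP : 0 < u * (1 + c) - a ^ 2 := by
    have : u * (1 + c) - a ^ 2 = 4 * c * (1 - x) := by subst ha; linear_combination hx' / 2
    rw [this]; have : 0 < 1 - x := by linarith
    positivity
  -- With `x` eliminated, criticality in `u` is linear in `ν`. Its signs confine `u` to `[a, a +
  -- 4c)`, and it serves below to eliminate `ν` from the discriminant.
  have hS : ν * u * (u * (1 + c) - a ^ 2) * (4 * c + a - u) = a * c * (u ^ 2 - a ^ 2) := by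
    have h1 : 4 * c ^ 2 * (u * (2 * ν * (1 - c) + 2 * (u - 1 - c) * (1 + ν)
        + 2 * x * ((1 + ν) * (1 + c) - ν * (u - 1 - c)) - 4 * ν * x ^ 2)
        - ((1 - c) ^ 2 + (u - 1 - c) ^ 2 + 2 * (u - 1 - c) * (1 + c) * x + 4 * c * x ^ 2))
        = a * (ν * u * (u * (1 + c) - a ^ 2) * (4 * c + a - u) - a * c * (u ^ 2 - a ^ 2)) := by
      subst ha
      rw [hxe]
      field_simp
      ring
    rw [hu', sub_self, mul_zero] at h1
    have h2 := (mul_eq_zero.mp h1.symm).resolve_left ha0.ne'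
    linarith
  have hua : a ≤ u := by
    by_contra! h
    have h1 : 0 ≤ ν * u * (u * (1 + c) - a ^ 2) * (4 * c + a - u) := by
      have : 0 < 4 * c + a - u := by linarith
      positivity
    have h2 : a * c * (u ^ 2 - a ^ 2) < 0 :=
      mul_neg_of_pos_of_neg (by positivity) (by nlinarith)
    linarith
  have hR : u < a + 4 * c := by
    by_contra! h
    have h1 : ν * u * (u * (1 + c) - a ^ 2) * (4 * c + a - u) ≤ 0 :=
      mul_nonpos_of_nonneg_of_nonpos (by positivity) (by linarith)
    have h2 : 0 < a * c * (u ^ 2 - a ^ 2) := mul_pos (by positivity) (by nlinarith)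
    linarith
  have hK := discriminant_poly_pos ha0 hc (by linarith) hua hR
  have hR' : 0 < 4 * c + a - u := by linarith
  rw [← sub_pos]
  have hH : (u * (1 + c) - a ^ 2) ^ 2 * (4 * c + a - u) ^ 2 * c ^ 2 * u ^ 2 *
      ((2 * ((1 + ν) * (1 + c) - ν * (u - 1 - c)) - 8 * ν * x) ^ 2 -
      16 * c * (ν ^ 2 + (1 + ν) ^ 2 - 2 * ν * (1 + ν) * x))
      = 4 * a ^ 2 * c ^ 2 * (u ^ 2 * (u * (1 + c) - a ^ 2) ^ 2 * (4 * c + a - u) ^ 2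
      + 2 * u * (u ^ 2 - a ^ 2) * (u * (1 + c) - a ^ 2) * (4 * c + a - u)
        * (u * (1 + c) - a - 2 * (1 + c) * c)
      + (u ^ 2 - a ^ 2) ^ 2 * ((u - a * (1 + c)) ^ 2 - 2 * c ^ 2 * (u * (1 + c) - a ^ 2))) := by
    have h1 : c ^ 2 * u ^ 2 * ((2 * ((1 + ν) * (1 + c) - ν * (u - 1 - c)) - 8 * ν * x) ^ 2 -
      16 * c * (ν ^ 2 + (1 + ν) ^ 2 - 2 * ν * (1 + ν) * x)) =
      4 * (c ^ 2 * a ^ 2 * u ^ 2 + 2 * u * a * c * (u * (1 + c) - a - 2 * (1 + c) * c) * (ν * u)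
        + (ν * u) ^ 2 * ((u - a * (1 + c)) ^ 2 - 2 * c ^ 2 * (u * (1 + c) - a ^ 2))) := by
      subst ha
      rw [hxe]
      field_simp
      ring
    linear_combination (u * (1 + c) - a ^ 2) ^ 2 * (4 * c + a - u) ^ 2 * h1
      + 4 * (2 * u * a * c * (u * (1 + c) - a - 2 * (1 + c) * c) *
        (u * (1 + c) - a ^ 2) * (4 * c + a - u)
        + ((u - a * (1 + c)) ^ 2 - 2 * c ^ 2 * (u * (1 + c) - a ^ 2)) *
          (ν * u * (u * (1 + c) - a ^ 2) * (4 * c + a - u) + a * c * (u ^ 2 - a ^ 2))) * hS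
  refine pos_of_mul_pos_right (hH ▸ by positivity) (by positivity :
    0 ≤ (u * (1 + c) - a ^ 2) ^ 2 * (4 * c + a - u) ^ 2 * c ^ 2 * u ^ 2)

lemma sqModulus_one (β ν u : ℝ) : sqModulus β ν 1 u = u ^ 2 := by
  unfold sqModulus; ring

lemma sqModulus_neg_one (β ν u : ℝ) :
    sqModulus β ν (-1) u = (2 * (1 + (β - ν * u)) - u) ^ 2 := by
  unfold sqModulus; ring

/-- If the bound `t u ≤ |z² + b z + c|²` holds on the whole unit circle at two stable parameters,
then it holds at all the parameters in between. -/
theorem le_sqModulus_of_endpoints {β ν t u₀ u₁ : ℝ} (hν : 0 ≤ ν) (hu₀ : 0 < u₀)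
    (hc : β - ν * u₀ < 1) (hb : u₁ < 2 * (1 + (β - ν * u₁)))
    (h₀ : ∀ x ∈ Set.Icc (-1 : ℝ) 1, t * u₀ ≤ sqModulus β ν x u₀)
    (h₁ : ∀ x ∈ Set.Icc (-1 : ℝ) 1, t * u₁ ≤ sqModulus β ν x u₁)
    {x u : ℝ} (hx : x ∈ Set.Icc (-1 : ℝ) 1) (hu : u ∈ Set.Icc u₀ u₁) :
    t * u ≤ sqModulus β ν x u := by
  have hcont : ContinuousOn (fun q : ℝ × ℝ => sqModulus β ν q.1 q.2 / q.2)
      (Set.Icc (-1 : ℝ) 1 ×ˢ Set.Icc u₀ u₁) := by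
    refine ContinuousOn.div ?_ continuousOn_snd fun q hq => (hu₀.trans_le hq.2.1).ne'
    unfold sqModulus
    fun_prop
  obtain ⟨⟨y, v⟩, ⟨hy, hv⟩, hmin⟩ :=
    (isCompact_Icc.prod isCompact_Icc).exists_isMinOn ⟨(x, u), hx, hu⟩ hcont
  simp only at hy hv
  have hmin' : ∀ x' ∈ Set.Icc (-1 : ℝ) 1, ∀ u' ∈ Set.Icc u₀ u₁,
      sqModulus β ν y v / v * u' ≤ sqModulus β ν x' u' := fun x' hx' u' hu' => by
    have := isMinOn_iff.mp hmin (x', u') (Set.mk_mem_prod hx' hu')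
    exact (le_div_iff₀ (hu₀.trans_le hu'.1)).mp this
  clear hmin hcont
  have hv0 : 0 < v := hu₀.trans_le hv.1
  obtain ⟨s, hs⟩ : ∃ s, s = sqModulus β ν y v / v := ⟨_, rfl⟩
  have hsv : sqModulus β ν y v = s * v := by rw [hs]; field_simp
  rw [← hs] at hmin'
  by_contra! hlt
  have hst : s < t := by
    by_contra! hts
    have h2 := hmin' x hx u hu
    have h3 := mul_le_mul_of_nonneg_right hts (hu₀.le.trans hu.1)
    linarith
  have hu01 : u₀ ≤ u₁ := hu.1.trans hu.2
  have hv₀ : u₀ < v := by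
    refine lt_of_le_of_ne hv.1 ?_
    rintro rfl
    have := h₀ y hy
    nlinarith
  have hv₁ : v < u₁ := by
    refine lt_of_le_of_ne hv.2 ?_
    rintro rfl
    have := h₁ y hy
    nlinarith
  -- At `x = 1` the ratio `F/u` equals `u`, so its minimum is at most `u₀ < v`.
  have hone : s < v := by
    have h2 := hmin' 1 (by norm_num) u₀ ⟨le_rfl, hu01⟩
    rw [sqModulus_one] at h2
    have : s ≤ u₀ := by nlinarith
    linarith
  have hy1 : y ≠ 1 := by
    rintro rfl
    rw [sqModulus_one] at hsv
    nlinarith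
  -- At `x = -1`, `F` is the square of an affine function nonincreasing in `u` and positive at `u₁`.
  -- So `F` is at least its value at `u₁`, which is too large for the minimum.
  have hym1 : y ≠ -1 := by
    rintro rfl
    rw [sqModulus_neg_one] at hsv
    have h2 := h₁ (-1) (by norm_num)
    rw [sqModulus_neg_one] at h2
    have h3 : 2 * (1 + (β - ν * u₁)) - u₁ ≤ 2 * (1 + (β - ν * v)) - v := by nlinarith
    have h4 : (2 * (1 + (β - ν * u₁)) - u₁) ^ 2 ≤ (2 * (1 + (β - ν * v)) - v) ^ 2 :=
      pow_le_pow_left₀ (by linarith) h3 2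
    have h5 : s * v < t * u₁ := by
      have : 0 ≤ s * v := hsv ▸ sq_nonneg _
      have : 0 ≤ s := nonneg_of_mul_nonneg_left this hv0
      nlinarith
    linarith
  have hy' : -1 < y ∧ y < 1 := ⟨lt_of_le_of_ne hy.1 hym1.symm, lt_of_le_of_ne hy.2 hy1⟩
  obtain ⟨c, hcv⟩ : ∃ c, c = β - ν * v := ⟨_, rfl⟩
  have hβ : β = c + ν * v := by linarith
  have hc1 : c < 1 := by nlinarith
  -- The gradient vanishes and the Hessian is nonnegative along every direction `(ξ, η)`. Working
  -- with `F - s u` instead of `F/u` keeps everything polynomial.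
  have hcoef : ∀ ξ η : ℝ,
      ξ * (2 * (v - 1 - c) * (1 + c) + 8 * c * y) + η * (2 * ν * (1 - c) + 2 * (v - 1 - c) * (1 + ν)
        + 2 * y * ((1 + ν) * (1 + c) - ν * (v - 1 - c)) - 4 * ν * y ^ 2 - s) = 0 ∧
      0 ≤ 4 * c * ξ ^ 2 + (2 * ((1 + ν) * (1 + c) - ν * (v - 1 - c)) - 8 * ν * y) * (ξ * η)
        + (ν ^ 2 + (1 + ν) ^ 2 - 2 * ν * (1 + ν) * y) * η ^ 2 := by
    intro ξ η
    have hev : ∀ᶠ h in nhds (0 : ℝ), (y + h * ξ ∈ Set.Ioo (-1 : ℝ) 1) ∧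
        (v + h * η ∈ Set.Ioo u₀ u₁) := by
      have c1 : Continuous fun h : ℝ => y + h * ξ := by fun_prop
      have c2 : Continuous fun h : ℝ => v + h * η := by fun_prop
      exact (c1.continuousAt.eventually_mem (Ioo_mem_nhds (by simp [hy']) (by simp [hy']))).and
        (c2.continuousAt.eventually_mem (Ioo_mem_nhds (by simp [hv₀]) (by simp [hv₁])))
    obtain ⟨δ, hδ, hball⟩ := Metric.eventually_nhds_iff.mp hev
    refine nonneg_cubic_coeff (c₃ := 2 * ξ * η ^ 2 * (-(ν * (1 + ν))) - 4 * ν * ξ ^ 2 * η)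
      hδ fun h hh => ?_
    obtain ⟨m1, m2⟩ := hball (y := h) (by simpa using hh)
    have hm := hmin' _ (Set.Ioo_subset_Icc_self m1) _ (Set.Ioo_subset_Icc_self m2)
    rw [← sub_nonneg] at hm
    have hz : sqModulus β ν y v - s * v = 0 := by linarith
    refine hm.trans_eq ?_
    unfold sqModulus at hz ⊢
    rw [hβ] at hz ⊢
    linear_combination hz
  have hgx := (hcoef 1 0).1
  have hgu := (hcoef 0 1).1
  simp only [one_mul, zero_mul, add_zero, zero_add] at hgx hgu
  have hval : (1 - c) ^ 2 + (v - 1 - c) ^ 2 + 2 * (v - 1 - c) * (1 + c) * y + 4 * c * y ^ 2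
      = s * v := by
    rw [← hsv, hβ]; unfold sqModulus; ring
  have hc0 : 0 < c := by
    by_contra! hneg
    -- Exact Taylor expansion in `x` from the critical point `y` to `1`, where `F = v²`. For `c ≤ 0`
    -- it would give `v ≤ s`.
    have h2 : v ^ 2 = s * v + 4 * c * (1 - y) ^ 2 := by
      linear_combination hval + (1 - y) * hgx
    have h3 : 4 * c * (1 - y) ^ 2 ≤ 0 :=
      mul_nonpos_of_nonpos_of_nonneg (by linarith) (sq_nonneg _)
    nlinarith
  have hdisc := hessian_indefinite (ν := ν) (x := y) (u := v) (c := c) hν hy'.2 hv0 hc0 hc1 hgx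
    (by rw [hval]; linear_combination v * hgu)
  -- For a form `Aξ² + Bξη + Cη²` the direction `(-B, 2A)` yields `A(4AC - B²)`; here `A = 4c`.
  have hneg := (hcoef (-(2 * ((1 + ν) * (1 + c) - ν * (v - 1 - c)) - 8 * ν * y)) (8 * c)).2
  nlinarith [mul_lt_mul_of_pos_left hdisc hc0]

/-! ### Scalar modes and their Schur stability. -/

/-- The characteristic polynomial `z² + b_λ z + c_λ` of the mode with eigenvalue `l`. -/
noncomputable def modeValue (α β ν l : ℝ) (z : ℂ) : ℂ :=
  z ^ 2 + bCoef α β ν l * z + cCoef α β ν l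

lemma continuous_modeValue (α β ν l : ℝ) : Continuous (modeValue α β ν l) := by
  unfold modeValue; fun_prop

/-- The coefficients are real, so on the circle only `Re z` matters; `1 + b + c = αλ` gives the form
of `b` in `sqModulus`. -/
lemma norm_sq_modeValue {α β ν l : ℝ} {z : ℂ} (hz : ‖z‖ = 1) :
    ‖modeValue α β ν l z‖ ^ 2 = sqModulus β ν z.re (α * l) := by
  have h : z.re ^ 2 + z.im ^ 2 = 1 := by
    have := Complex.sq_norm z
    rw [hz, Complex.normSq_apply] at this
    linarith
  have him : z.im ^ 2 = 1 - z.re ^ 2 := by linarith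
  have him4 : z.im ^ 4 = (1 - z.re ^ 2) ^ 2 := by rw [← him]; ring
  rw [Complex.sq_norm, Complex.normSq_apply]
  simp only [modeValue, bCoef, cCoef, sqModulus, pow_two z, Complex.add_re, Complex.add_im,
    Complex.mul_re, Complex.mul_im, Complex.ofReal_re, Complex.ofReal_im]
  ring_nf
  rw [him4, him]
  ring

/-- `c` is the product of the two roots. -/
lemma abs_cCoef_lt_one_of_stable {α β ν l : ℝ} (h : ∀ z : ℂ, modeValue α β ν l z = 0 → ‖z‖ < 1) :
    |cCoef α β ν l| < 1 := by
  obtain ⟨s, hs⟩ := IsAlgClosed.exists_pow_nat_eq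
    ((bCoef α β ν l : ℂ) ^ 2 - 4 * cCoef α β ν l) (n := 2) (by norm_num)
  have h1 := h ((-bCoef α β ν l + s) / 2) (by unfold modeValue; linear_combination hs / 4)
  have h2 := h ((-bCoef α β ν l - s) / 2) (by unfold modeValue; linear_combination hs / 4)
  have h3 : (cCoef α β ν l : ℂ)
      = ((-bCoef α β ν l + s) / 2) * ((-bCoef α β ν l - s) / 2) := by linear_combination hs / 4
  have h4 := congrArg norm h3
  rw [norm_mul, Complex.norm_real, Real.norm_eq_abs] at h4
  exact h4 ▸ mul_lt_one_of_nonneg_of_lt_one_left (norm_nonneg _) h1 h2.le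

/-- Otherwise the polynomial is nonpositive at `-1`, and its smaller real root is at most `-1`. -/
lemma bCoef_lt_of_stable {α β ν l : ℝ} (h : ∀ z : ℂ, modeValue α β ν l z = 0 → ‖z‖ < 1) :
    bCoef α β ν l < 1 + cCoef α β ν l := by
  by_contra! hle
  have hc := abs_lt.mp (abs_cCoef_lt_one_of_stable h)
  set b := bCoef α β ν l with hb
  set c := cCoef α β ν l with hcc
  have hdisc : (1 - c) ^ 2 ≤ b ^ 2 - 4 * c := by nlinarith
  have hs : 1 - c ≤ √(b ^ 2 - 4 * c) := Real.le_sqrt_of_sq_le hdisc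
  have hsq : √(b ^ 2 - 4 * c) ^ 2 = b ^ 2 - 4 * c := Real.sq_sqrt ((sq_nonneg _).trans hdisc)
  have hr := h (((-b - √(b ^ 2 - 4 * c)) / 2 : ℝ)) (by
    unfold modeValue
    rw [← hb, ← hcc]
    norm_cast
    linear_combination hsq / 4)
  rw [Complex.norm_real, Real.norm_eq_abs, abs_lt] at hr
  linarith [hr.1]

/-! ### Eigenvectors and spectral norms. -/

section Spectrum

variable {m : Type*} [Fintype m] [DecidableEq m]

lemma mem_spectrum_iff_exists_mulVec (M : Matrix m m ℂ) (z : ℂ) :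
    z ∈ spectrum ℂ M ↔ ∃ v : m → ℂ, v ≠ 0 ∧ M *ᵥ v = z • v := by
  rw [← Matrix.spectrum_toLin', ← Module.End.hasEigenvalue_iff_mem_spectrum]
  constructor
  · intro h
    obtain ⟨v, hv⟩ := h.exists_hasEigenvector
    exact ⟨v, hv.2, by simpa using hv.apply_eq_smul⟩
  · rintro ⟨v, hv, h⟩
    exact Module.End.hasEigenvalue_of_hasEigenvector
      ⟨Module.End.mem_eigenspace_iff.mpr (by simpa using h), hv⟩

lemma nnnorm_le_specRadius {M : Matrix m m ℂ} {z : ℂ} {v : m → ℂ} (hv : v ≠ 0)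
    (h : M *ᵥ v = z • v) : (‖z‖₊ : ℝ≥0∞) ≤ specRadius M :=
  le_iSup₂ (f := fun (k : ℂ) (_ : k ∈ spectrum ℂ M) => (‖k‖₊ : ℝ≥0∞)) z
    ((mem_spectrum_iff_exists_mulVec M z).mpr ⟨v, hv, h⟩)

lemma specRadius_le {M : Matrix m m ℂ} {R : NNReal}
    (h : ∀ (z : ℂ) (v : m → ℂ), v ≠ 0 → M *ᵥ v = z • v → ‖z‖₊ ≤ R) : specRadius M ≤ R :=
  iSup₂_le fun z hz => by
    obtain ⟨v, hv, hzv⟩ := (mem_spectrum_iff_exists_mulVec M z).mp hz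
    exact_mod_cast h z v hv hzv

end Spectrum

section Norms

variable {n : Type*} [Fintype n] [DecidableEq n]

lemma sum_norm_sq_mulVec_le {𝕜 : Type*} [RCLike 𝕜] (M : Matrix n n 𝕜) (x : n → 𝕜) :
    ∑ i, ‖(M *ᵥ x) i‖ ^ 2 ≤ ‖M‖ ^ 2 * ∑ i, ‖x i‖ ^ 2 := by
  have h := pow_le_pow_left₀ (norm_nonneg _) (Matrix.l2_opNorm_mulVec M (WithLp.toLp 2 x)) 2
  rw [mul_pow, EuclideanSpace.norm_sq_eq, EuclideanSpace.norm_sq_eq] at h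
  simpa using h

lemma norm_le_of_sum_norm_sq_mulVec_le {𝕜 : Type*} [RCLike 𝕜] (M : Matrix n n 𝕜) {C : ℝ}
    (hC : 0 ≤ C) (h : ∀ x : n → 𝕜, ∑ i, ‖(M *ᵥ x) i‖ ^ 2 ≤ C ^ 2 * ∑ i, ‖x i‖ ^ 2) :
    ‖M‖ ≤ C := by
  rw [Matrix.l2_opNorm_def]
  refine ContinuousLinearMap.opNorm_le_bound _ hC fun x => ?_
  refine (sq_le_sq₀ (norm_nonneg _) (by positivity)).mp ?_
  rw [mul_pow, EuclideanSpace.norm_sq_eq, EuclideanSpace.norm_sq_eq]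
  simpa using h x.ofLp

/-- A real matrix acts separately on real and imaginary parts. -/
lemma norm_toC_le (M : Matrix n n ℝ) : ‖toC M‖ ≤ ‖M‖ := by
  refine norm_le_of_sum_norm_sq_mulVec_le _ (norm_nonneg _) fun x => ?_
  have hre := sum_norm_sq_mulVec_le M (fun i => (x i).re)
  have him := sum_norm_sq_mulVec_le M (fun i => (x i).im)
  have h1 : ∀ i, ((toC M *ᵥ x) i).re = (M *ᵥ fun i => (x i).re) i := fun i => by
    simp [toC, Matrix.mulVec, dotProduct]
  have h2 : ∀ i, ((toC M *ᵥ x) i).im = (M *ᵥ fun i => (x i).im) i := fun i => by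
    simp [toC, Matrix.mulVec, dotProduct]
  have h3 : ∀ w : ℂ, ‖w‖ ^ 2 = ‖w.re‖ ^ 2 + ‖w.im‖ ^ 2 := fun w => by
    rw [Complex.sq_norm, Complex.normSq_apply, Real.norm_eq_abs, Real.norm_eq_abs, sq_abs, sq_abs]
    ring
  simp only [h3, h1, h2, Finset.sum_add_distrib, mul_add]
  linarith

end Norms

/-! ### Decoupling into modes in the eigenbasis. -/

section Modes

variable {d : ℕ} {U : Matrix (Fin d) (Fin d) ℝ}

lemma toC_mul {k l m : Type*} [Fintype l] (M : Matrix k l ℝ) (N : Matrix l m ℝ) :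
    toC (M * N) = toC M * toC N := by
  exact Matrix.map_mul (f := Complex.ofRealHom)

lemma toC_add {k l : Type*} (M N : Matrix k l ℝ) : toC (M + N) = toC M + toC N := by
  ext; simp [toC]

lemma toC_orthogonal (hU : U ∈ Matrix.orthogonalGroup (Fin d) ℝ) :
    toC U * toC Uᵀ = 1 ∧ toC Uᵀ * toC U = 1 := by
  rw [← toC_mul, ← toC_mul]
  have h1 := (Matrix.mem_orthogonalGroup_iff (Fin d) ℝ).mp hU
  have h2 := (Matrix.mem_orthogonalGroup_iff' (Fin d) ℝ).mp hU
  rw [h1, h2]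
  simp [toC]

lemma toC_mem_unitary (hU : U ∈ Matrix.orthogonalGroup (Fin d) ℝ) :
    toC U ∈ unitary (Matrix (Fin d) (Fin d) ℂ) ∧ toC Uᵀ ∈ unitary (Matrix (Fin d) (Fin d) ℂ) := by
  have h := toC_orthogonal hU
  have hs : star (toC U) = toC Uᵀ := by ext; simp [toC]
  have hs' : star (toC Uᵀ) = toC U := by ext; simp [toC]
  simp only [Unitary.mem_iff, hs, hs', h, and_self]

lemma sum_norm_sq_orthogonal (hU : U ∈ Matrix.orthogonalGroup (Fin d) ℝ) (x : Fin d → ℂ) :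
    ∑ i, ‖(toC U *ᵥ x) i‖ ^ 2 = ∑ i, ‖x i‖ ^ 2 := by
  have h := toC_mem_unitary hU
  have hle : ∀ V ∈ unitary (Matrix (Fin d) (Fin d) ℂ), ∀ x : Fin d → ℂ,
      ∑ i, ‖(V *ᵥ x) i‖ ^ 2 ≤ ∑ i, ‖x i‖ ^ 2 := fun V hV x => by
    refine (sum_norm_sq_mulVec_le V x).trans (mul_le_of_le_one_left (by positivity) ?_)
    have h1 : ‖V‖ ≤ 1 := by
      rcases isEmpty_or_nonempty (Fin d) with he | he
      · rw [Subsingleton.elim V 0, norm_zero]; exact zero_le_one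
      · exact (CStarRing.norm_of_mem_unitary hV).le
    exact pow_le_one₀ (norm_nonneg _) h1
  refine le_antisymm (hle _ h.1 x) ?_
  have := hle _ h.2 (toC U *ᵥ x)
  rwa [Matrix.mulVec_mulVec, (toC_orthogonal hU).2, Matrix.one_mulVec] at this

variable {lam : Fin d → ℝ} {Q : Matrix (Fin d) (Fin d) ℝ}

lemma toC_decomposition_mulVec (hU : U ∈ Matrix.orthogonalGroup (Fin d) ℝ)
    (hdecomp : Q = U * Matrix.diagonal lam * Uᵀ) (η : Fin d → ℂ) :
    toC Q *ᵥ (toC U *ᵥ η) = toC U *ᵥ fun i => (lam i : ℂ) * η i := by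
  rw [hdecomp, toC_mul, toC_mul, Matrix.mulVec_mulVec, Matrix.mul_assoc, (toC_orthogonal hU).2,
    Matrix.mul_one, ← Matrix.mulVec_mulVec]
  congr 1
  ext i
  simp [toC, Matrix.diagonal_map, Matrix.mulVec_diagonal]

/-- The action of the state matrix on a vector of the form `(z y, y)` in modal coordinates. -/
lemma stateMatrix_mulVec (hU : U ∈ Matrix.orthogonalGroup (Fin d) ℝ)
    (hdecomp : Q = U * Matrix.diagonal lam * Uᵀ) (α β ν : ℝ) (z : ℂ) (η : Fin d → ℂ) :
    toC (stateMatrix α β ν Q) *ᵥ Sum.elim (z • (toC U *ᵥ η)) (toC U *ᵥ η)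
      = z • Sum.elim (z • (toC U *ᵥ η)) (toC U *ᵥ η)
        - Sum.elim (toC U *ᵥ fun i => modeValue α β ν (lam i) z * η i) 0 := by
  have hA : toC (stateMatrix α β ν Q) = Matrix.fromBlocks
      ((1 + β : ℂ) • (1 : Matrix (Fin d) (Fin d) ℂ) - ((α : ℂ) * (1 + ν)) • toC Q)
      (-((β : ℂ) • (1 : Matrix (Fin d) (Fin d) ℂ)) + ((α : ℂ) * ν) • toC Q) 1 0 := by
    ext i j
    rcases i with i | i <;> rcases j with j | j <;>
      by_cases hij : i = j <;> simp [toC, stateMatrix, hij]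
  have hmode : (fun i => modeValue α β ν (lam i) z * η i) = (z ^ 2 - (1 + β) * z + β) • η
      + (α * (1 + ν) * z - α * ν) • fun i => (lam i : ℂ) * η i := by
    ext i
    simp only [modeValue, bCoef, cCoef, Pi.add_apply, Pi.smul_apply, smul_eq_mul]
    push_cast
    ring
  rw [hA, Matrix.fromBlocks_mulVec, hmode, Matrix.mulVec_add, Matrix.mulVec_smul,
    Matrix.mulVec_smul, ← toC_decomposition_mulVec hU hdecomp]
  generalize toC U *ᵥ η = y
  ext i
  rcases i with i | i
  · simp [Matrix.add_mulVec, Matrix.sub_mulVec, Matrix.smul_mulVec, Matrix.neg_mulVec,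
      Matrix.mulVec_smul]
    ring
  · simp

lemma inputMatrix_mulVec (α : ℝ) (w : Fin d → ℂ) :
    toC (inputMatrix d α) *ᵥ w = Sum.elim (-(α : ℂ) • w) 0 := by
  have hB : toC (inputMatrix d α)
      = Matrix.fromRows (-((α : ℂ) • (1 : Matrix (Fin d) (Fin d) ℂ))) 0 := by
    ext i j
    rcases i with i | i <;> by_cases hij : i = j <;>
      simp [toC, inputMatrix, hij]
  rw [hB, Matrix.fromRows_mulVec]
  simp [Matrix.neg_mulVec, Matrix.smul_mulVec]

lemma outputMatrix_mulVec (hU : U ∈ Matrix.orthogonalGroup (Fin d) ℝ) (z : ℂ) (η : Fin d → ℂ) :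
    toC (outputMatrix U lam) *ᵥ Sum.elim (z • (toC U *ᵥ η)) (toC U *ᵥ η)
      = fun i => z * (1 / √2 * √(lam i) * η i : ℂ) := by
  have hT : toC (outputMatrix U lam) = Matrix.fromCols
      (Matrix.diagonal (fun i => (1 / √2 * √(lam i) : ℂ)) * toC Uᵀ) 0 := by
    ext i j
    rcases j with j | j <;>
      simp [toC, outputMatrix, Matrix.diagonal_mul, mul_assoc]
  rw [hT, Matrix.fromCols_mulVec_sumElim, Matrix.zero_mulVec, add_zero, Matrix.mulVec_smul,
    ← Matrix.mulVec_mulVec, Matrix.mulVec_mulVec _ (toC Uᵀ), (toC_orthogonal hU).2,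
    Matrix.one_mulVec]
  ext i
  simp [Matrix.mulVec_diagonal]

/-- A perturbed eigenvalue equation in modal coordinates. -/
lemma perturbed_mulVec_eq_smul_iff (hU : U ∈ Matrix.orthogonalGroup (Fin d) ℝ)
    (hdecomp : Q = U * Matrix.diagonal lam * Uᵀ) (α β ν : ℝ) (Δ : Matrix (Fin d) (Fin d) ℂ)
    (z : ℂ) (η : Fin d → ℂ) :
    (toC (stateMatrix α β ν Q) + toC (inputMatrix d α) * Δ * toC (outputMatrix U lam)) *ᵥ
        Sum.elim (z • (toC U *ᵥ η)) (toC U *ᵥ η) = z • Sum.elim (z • (toC U *ᵥ η)) (toC U *ᵥ η)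
      ↔ (toC U *ᵥ fun i => modeValue α β ν (lam i) z * η i)
        = -(α : ℂ) • Δ *ᵥ fun i => z * (1 / √2 * √(lam i) * η i : ℂ) := by
  rw [Matrix.add_mulVec, stateMatrix_mulVec hU hdecomp, ← Matrix.mulVec_mulVec,
    ← Matrix.mulVec_mulVec, outputMatrix_mulVec hU, inputMatrix_mulVec]
  constructor
  · intro h
    ext i
    have := congrFun h (Sum.inl i)
    simp only [Pi.add_apply, Pi.sub_apply, Sum.elim_inl] at this
    linear_combination -this
  · intro h
    rw [h]
    simp

/-- An eigenvector of the perturbed state matrix has the form `(z y, y)`. -/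
lemma exists_modes_of_perturbed_eigenvector (hU : U ∈ Matrix.orthogonalGroup (Fin d) ℝ)
    (α β ν : ℝ) (Δ : Matrix (Fin d) (Fin d) ℂ)
    {z : ℂ} {v : Fin d ⊕ Fin d → ℂ} (hv : v ≠ 0)
    (h : (toC (stateMatrix α β ν Q) + toC (inputMatrix d α) * Δ * toC (outputMatrix U lam)) *ᵥ v
      = z • v) :
    ∃ η : Fin d → ℂ, η ≠ 0 ∧ v = Sum.elim (z • (toC U *ᵥ η)) (toC U *ᵥ η) := by
  have hbot : ∀ i, v (Sum.inl i) = z * v (Sum.inr i) := fun i => by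
    have := congrFun h (Sum.inr i)
    rw [Matrix.add_mulVec, ← Matrix.mulVec_mulVec, ← Matrix.mulVec_mulVec,
      inputMatrix_mulVec] at this
    have hA : (toC (stateMatrix α β ν Q) *ᵥ v) (Sum.inr i) = v (Sum.inl i) := by
      simp [toC, stateMatrix, Matrix.mulVec, dotProduct, Matrix.one_apply,
        apply_ite Complex.ofReal]
    simpa [hA] using this
  have hη : toC U *ᵥ (toC Uᵀ *ᵥ fun i => v (Sum.inr i)) = fun i => v (Sum.inr i) := by
    rw [Matrix.mulVec_mulVec, (toC_orthogonal hU).1, Matrix.one_mulVec]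
  have hform : v = Sum.elim (z • (toC U *ᵥ (toC Uᵀ *ᵥ fun i => v (Sum.inr i))))
      (toC U *ᵥ (toC Uᵀ *ᵥ fun i => v (Sum.inr i))) := by
    rw [hη]
    ext i
    rcases i with i | i
    · simp [hbot]
    · simp
  refine ⟨_, fun h0 => hv ?_, hform⟩
  rw [hform, h0]
  ext i
  rcases i with i | i <;> simp

lemma elim_modes_ne_zero (hU : U ∈ Matrix.orthogonalGroup (Fin d) ℝ) (z : ℂ) {η : Fin d → ℂ}
    (hη : η ≠ 0) : Sum.elim (z • (toC U *ᵥ η)) (toC U *ᵥ η) ≠ 0 := by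
  intro h
  apply hη
  have h1 : toC U *ᵥ η = 0 := by
    ext i
    simpa using congrFun h (Sum.inr i)
  have h2 := congrArg (toC Uᵀ *ᵥ ·) h1
  simpa [Matrix.mulVec_mulVec, (toC_orthogonal hU).2] using h2

/-- All the modes of a convergent iteration are Schur stable. -/
lemma norm_lt_one_of_modeValue_eq_zero (hU : U ∈ Matrix.orthogonalGroup (Fin d) ℝ)
    (hdecomp : Q = U * Matrix.diagonal lam * Uᵀ) {α β ν : ℝ}
    (hρ : specRadius (toC (stateMatrix α β ν Q)) < 1) (i : Fin d) {z : ℂ}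
    (hz : modeValue α β ν (lam i) z = 0) : ‖z‖ < 1 := by
  have hη : (Pi.single i 1 : Fin d → ℂ) ≠ 0 := by simp
  have h0 : (fun j => modeValue α β ν (lam j) z * (Pi.single i 1 : Fin d → ℂ) j) = 0 := by
    ext j
    by_cases hij : j = i
    · subst hij; simp [hz]
    · simp [hij]
  have hv := stateMatrix_mulVec hU hdecomp α β ν z (Pi.single i 1)
  rw [h0, Matrix.mulVec_zero] at hv
  have := (nnnorm_le_specRadius (z := z) (elim_modes_ne_zero hU z hη) (hv.trans (by
    ext j; rcases j with j | j <;> simp))).trans_lt hρ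
  exact_mod_cast this

/-- The resolvent equation is solved by a vector `(z y, y)`, on which `zI - A` acts mode by mode as
multiplication by `modeValue`. -/
lemma transferMatrix_eq (hU : U ∈ Matrix.orthogonalGroup (Fin d) ℝ)
    (hdecomp : Q = U * Matrix.diagonal lam * Uᵀ) {α β ν : ℝ} {z : ℂ}
    (hz : ∀ i, modeValue α β ν (lam i) z ≠ 0) :
    transferMatrix (stateMatrix α β ν Q) (inputMatrix d α) (outputMatrix U lam) z
      = Matrix.diagonal (fun i => -(α : ℂ) * (z * (1 / √2 * √(lam i))) / modeValue α β ν (lam i) z)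
        * toC Uᵀ := by
  have hunit : IsUnit (z • (1 : Matrix (Fin d ⊕ Fin d) (Fin d ⊕ Fin d) ℂ)
      - toC (stateMatrix α β ν Q)) := by
    by_contra hnot
    have hmem : z ∈ spectrum ℂ (toC (stateMatrix α β ν Q)) := by
      rwa [spectrum.mem_iff, Algebra.algebraMap_eq_smul_one]
    obtain ⟨v, hv, hzv⟩ := (mem_spectrum_iff_exists_mulVec _ _).mp hmem
    obtain ⟨η, hη, rfl⟩ := exists_modes_of_perturbed_eigenvector (lam := lam) hU α β ν 0 hv
      (by simpa using hzv)
    have h1 := (perturbed_mulVec_eq_smul_iff hU hdecomp α β ν 0 z η).mp (by simpa using hzv)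
    have h2 := congrArg (toC Uᵀ *ᵥ ·) h1
    simp only [Matrix.mulVec_mulVec, (toC_orthogonal hU).2, Matrix.one_mulVec,
      Matrix.zero_mulVec, smul_zero, Matrix.mulVec_zero] at h2
    apply hη
    ext i
    simpa [hz i] using congrFun h2 i
  refine Matrix.ext_of_mulVec_single fun j => ?_
  set w : Fin d → ℂ := Pi.single j 1
  obtain ⟨η, hη⟩ : ∃ η : Fin d → ℂ,
      η = fun i => -(α : ℂ) * (toC Uᵀ *ᵥ w) i / modeValue α β ν (lam i) z := ⟨_, rfl⟩
  have hres : (z • (1 : Matrix (Fin d ⊕ Fin d) (Fin d ⊕ Fin d) ℂ) - toC (stateMatrix α β ν Q)) *ᵥ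
      Sum.elim (z • (toC U *ᵥ η)) (toC U *ᵥ η) = toC (inputMatrix d α) *ᵥ w := by
    rw [Matrix.sub_mulVec, Matrix.smul_mulVec, Matrix.one_mulVec, stateMatrix_mulVec hU hdecomp,
      inputMatrix_mulVec, sub_sub_cancel]
    have h1 : (fun i => modeValue α β ν (lam i) z * η i) = -(α : ℂ) • (toC Uᵀ *ᵥ w) := by
      ext i
      have := hz i
      simp only [hη, Pi.smul_apply, smul_eq_mul]
      field_simp
    rw [h1, Matrix.mulVec_smul, Matrix.mulVec_mulVec, (toC_orthogonal hU).1, Matrix.one_mulVec]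
  rw [transferMatrix, ← Matrix.mulVec_mulVec, ← hres, Matrix.mulVec_mulVec, Matrix.mul_assoc,
    Matrix.nonsing_inv_mul _ ((Matrix.isUnit_iff_isUnit_det _).mp hunit), Matrix.mul_one,
    outputMatrix_mulVec hU, ← Matrix.mulVec_mulVec]
  ext i
  simp only [hη, Matrix.mulVec_diagonal]
  ring

end Modes

/-! ### Gain bounds for intermediate modes and outside the unit circle. -/

lemma gainTerm_eq (α β ν ω l : ℝ) :
    gainTerm α β ν ω l = √l / ‖modeValue α β ν l (Complex.exp (Complex.I * ω))‖ := by
  rw [gainTerm, modeValue, ← Complex.exp_nat_mul]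
  congr 5
  push_cast
  ring

lemma exists_exp_eq_of_norm_eq_one {z : ℂ} (hz : ‖z‖ = 1) :
    ∃ ω ∈ Set.Icc 0 (2 * Real.pi), Complex.exp (Complex.I * ω) = z := by
  have h := Complex.norm_mul_exp_arg_mul_I z
  rw [hz, Complex.ofReal_one, one_mul] at h
  rcases le_or_gt 0 z.arg with h0 | h0
  · exact ⟨z.arg, ⟨h0, by linarith [Complex.arg_le_pi z, Real.pi_pos]⟩, by rwa [mul_comm]⟩
  · refine ⟨z.arg + 2 * Real.pi, ⟨by linarith [Complex.neg_pi_lt_arg z, Real.pi_pos],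
      by linarith⟩, ?_⟩
    push_cast
    rw [mul_comm, add_mul, Complex.exp_add, Complex.exp_two_pi_mul_I, mul_one, h]

/-- A gain bound for two stable modes is inherited by every mode in between. -/
lemma sqrt_le_mul_norm_modeValue {α β ν l₀ l₁ l M : ℝ} (hα : 0 < α) (hν : 0 ≤ ν) (hl₀ : 0 < l₀)
    (hl : l ∈ Set.Icc l₀ l₁) (hM : 0 < M)
    (hs₀ : ∀ z : ℂ, modeValue α β ν l₀ z = 0 → ‖z‖ < 1)
    (hs₁ : ∀ z : ℂ, modeValue α β ν l₁ z = 0 → ‖z‖ < 1)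
    (h₀ : ∀ z : ℂ, ‖z‖ = 1 → √l₀ ≤ M * ‖modeValue α β ν l₀ z‖)
    (h₁ : ∀ z : ℂ, ‖z‖ = 1 → √l₁ ≤ M * ‖modeValue α β ν l₁ z‖) {z : ℂ} (hz : ‖z‖ = 1) :
    √l ≤ M * ‖modeValue α β ν l z‖ := by
  have hbound : ∀ l' : ℝ, 0 ≤ l' → (∀ z : ℂ, ‖z‖ = 1 → √l' ≤ M * ‖modeValue α β ν l' z‖) →
      ∀ x ∈ Set.Icc (-1 : ℝ) 1, 1 / (α * M ^ 2) * (α * l') ≤ sqModulus β ν x (α * l') := by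
    intro l' hl' h x hx
    -- Every `x ∈ [-1, 1]` is the real part of a point of the circle; the squared gain bound there
    -- is the inequality with `t = 1/(αM²)`.
    have hw : ‖(⟨x, √(1 - x ^ 2)⟩ : ℂ)‖ = 1 := by
      rw [← sq_eq_sq₀ (norm_nonneg _) zero_le_one, Complex.sq_norm, Complex.normSq_apply,
        Real.mul_self_sqrt (by nlinarith [hx.1, hx.2])]
      ring
    have h2 := pow_le_pow_left₀ (Real.sqrt_nonneg _) (h _ hw) 2
    rw [mul_pow, norm_sq_modeValue hw, Real.sq_sqrt hl'] at h2
    have h3 : 1 / (α * M ^ 2) * (α * l') = l' / M ^ 2 := by field_simp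
    rw [h3, div_le_iff₀ (by positivity)]
    linarith
  have hl1 : 0 ≤ l₁ := hl₀.le.trans (hl.1.trans hl.2)
  have hc := (abs_lt.mp (abs_cCoef_lt_one_of_stable hs₀)).2
  have hb := bCoef_lt_of_stable hs₁
  have hmain := le_sqModulus_of_endpoints (β := β) hν (mul_pos hα hl₀)
    (by unfold cCoef at hc; linarith) (by unfold bCoef cCoef at hb; linarith)
    (hbound l₀ hl₀.le h₀) (hbound l₁ hl1 h₁)
    (x := z.re) (u := α * l) (abs_le.mp ((Complex.abs_re_le_norm z).trans hz.le))
    ⟨mul_le_mul_of_nonneg_left hl.1 hα.le, mul_le_mul_of_nonneg_left hl.2 hα.le⟩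
  rw [← norm_sq_modeValue hz] at hmain
  have h3 : 1 / (α * M ^ 2) * (α * l) = l / M ^ 2 := by field_simp
  rw [h3, div_le_iff₀ (by positivity)] at hmain
  exact Real.sqrt_le_iff.mpr ⟨by positivity, by rw [mul_pow]; linarith⟩

/-- The maximum modulus principle extends a gain bound from the unit circle to its exterior. -/
lemma sqrt_mul_norm_le {α β ν l M : ℝ}
    (hs : ∀ z : ℂ, modeValue α β ν l z = 0 → ‖z‖ < 1)
    (h : ∀ z : ℂ, ‖z‖ = 1 → √l ≤ M * ‖modeValue α β ν l z‖) {w : ℂ} (hw : ‖w‖ ≤ 1) :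
    √l * ‖w‖ ≤ M * ‖1 + bCoef α β ν l * w + cCoef α β ν l * w ^ 2‖ := by
  -- With `w = 1/z` the exterior becomes the unit disc, and stability keeps the reversed polynomial
  -- zero-free on its closure.
  have hrev : ∀ w : ℂ, w ≠ 0 → 1 + bCoef α β ν l * w + cCoef α β ν l * w ^ 2
      = w ^ 2 * modeValue α β ν l w⁻¹ := fun w hw => by
    unfold modeValue; field_simp
  have hne : ∀ w : ℂ, ‖w‖ ≤ 1 → 1 + bCoef α β ν l * w + cCoef α β ν l * w ^ 2 ≠ 0 := by
    intro w hw h0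
    by_cases hw0 : w = 0
    · simp [hw0] at h0
    · rw [hrev w hw0] at h0
      have h1 := hs _ ((mul_eq_zero.mp h0).resolve_left (pow_ne_zero 2 hw0))
      rw [norm_inv] at h1
      exact absurd h1 (not_lt.mpr ((one_le_inv₀ (norm_pos_iff.mpr hw0)).mpr hw))
  have hd : DiffContOnCl ℂ (fun w : ℂ => (√l : ℂ) * w /
      (1 + bCoef α β ν l * w + cCoef α β ν l * w ^ 2)) (Metric.ball 0 1) := by
    refine DifferentiableOn.diffContOnCl fun w hw => ?_
    rw [closure_ball _ one_ne_zero] at hw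
    have h1 : DifferentiableAt ℂ (fun w : ℂ => (√l : ℂ) * w) w := by fun_prop
    have h2 : DifferentiableAt ℂ
        (fun w : ℂ => 1 + bCoef α β ν l * w + cCoef α β ν l * w ^ 2) w := by fun_prop
    exact (h1.div h2 (hne w (by simpa using hw))).differentiableWithinAt
  have hfr := Complex.norm_le_of_forall_mem_frontier_norm_le Metric.isBounded_ball hd (C := M)
    (fun w hw => by
      rw [frontier_ball _ one_ne_zero] at hw
      have hw1 : ‖w‖ = 1 := by simpa using hw
      have hw0 : w ≠ 0 := by rintro rfl; simp at hw1
      have hpos := norm_pos_iff.mpr (hne w hw1.le)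
      rw [norm_div, div_le_iff₀ hpos, hrev w hw0, norm_mul, norm_mul, norm_pow, hw1,
        Complex.norm_real, Real.norm_of_nonneg (Real.sqrt_nonneg _), one_pow, one_mul, mul_one]
      exact h _ (by rw [norm_inv, hw1, inv_one]))
    (z := w) (by rw [closure_ball _ one_ne_zero]; simpa using hw)
  rwa [norm_div, div_le_iff₀ (norm_pos_iff.mpr (hne w hw)), norm_mul, Complex.norm_real,
    Real.norm_of_nonneg (Real.sqrt_nonneg _)] at hfr

/-! ### Stability radii: lower bound over `ℂ`, attainment over `ℝ`. -/

section Radius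

variable {d : ℕ} {U Q : Matrix (Fin d) (Fin d) ℝ} {lam : Fin d → ℝ} {α β ν : ℝ}

lemma rhoReal_le_rhoComplex {m n : Type*} [Fintype m] [DecidableEq m] [Fintype n] [DecidableEq n]
    (A : Matrix m m ℝ) (B : Matrix m n ℝ) (T : Matrix n m ℝ) (ε : ℝ) :
    rhoReal A B T ε ≤ rhoComplex A B T ε := by
  refine iSup_le fun Δ => ?_
  rw [toC_add, toC_mul, toC_mul]
  exact le_iSup (fun Δ : {Δ : Matrix n n ℂ // ‖Δ‖ ≤ ε} => specRadius (toC A + toC B * Δ.1 * toC T))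
    ⟨toC Δ.1, (norm_toC_le _).trans Δ.2⟩

/-- Small perturbations keep the iteration uniformly convergent. -/
lemma rhoComplex_lt_one (hU : U ∈ Matrix.orthogonalGroup (Fin d) ℝ)
    (hdecomp : Q = U * Matrix.diagonal lam * Uᵀ) (hα : 0 < α) {M ε : ℝ} (hε : 0 ≤ ε)
    (hs : ∀ i, ∀ z : ℂ, modeValue α β ν (lam i) z = 0 → ‖z‖ < 1)
    (h : ∀ i, ∀ z : ℂ, ‖z‖ = 1 → √(lam i) ≤ M * ‖modeValue α β ν (lam i) z‖)
    (hεM : ε * (α / √2 * M) < 1) :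
    rhoComplex (stateMatrix α β ν Q) (inputMatrix d α) (outputMatrix U lam) ε < 1 := by
  let S : Set ℂ := ⋂ i, {w : ℂ | ε * (α / √2) * (√(lam i) * ‖w‖)
    < ‖1 + bCoef α β ν (lam i) * w + cCoef α β ν (lam i) * w ^ 2‖}
  have hSopen : IsOpen S :=
    isOpen_iInter_of_finite fun i => isOpen_lt (by fun_prop) (by fun_prop)
  have hSball : Metric.closedBall (0 : ℂ) 1 ⊆ S := by
    intro w hw
    have hw1 : ‖w‖ ≤ 1 := by simpa using hw
    refine Set.mem_iInter.mpr fun i => ?_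
    have h1 := sqrt_mul_norm_le (hs i) (h i) hw1
    have hK : 0 ≤ ε * (α / √2) := by positivity
    have h2 := mul_le_mul_of_nonneg_left h1 hK
    rcases (norm_nonneg (1 + bCoef α β ν (lam i) * w + cCoef α β ν (lam i) * w ^ 2)).eq_or_lt
      with h0 | h0
    · exfalso
      have hne : w ≠ 0 := by rintro rfl; simp at h0
      have hzero : modeValue α β ν (lam i) w⁻¹ = 0 := by
        have : w ^ 2 * modeValue α β ν (lam i) w⁻¹ = 0 := by
          rw [← norm_eq_zero.mp h0.symm]; unfold modeValue; field_simp
        exact (mul_eq_zero.mp this).resolve_left (pow_ne_zero 2 hne)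
      have h3 := hs i _ hzero
      rw [norm_inv] at h3
      exact absurd h3 (not_lt.mpr ((one_le_inv₀ (norm_pos_iff.mpr hne)).mpr hw1))
    · refine h2.trans_lt ?_
      have h3 := mul_lt_mul_of_pos_right hεM h0
      rw [one_mul] at h3
      refine lt_of_eq_of_lt ?_ h3
      ring
  -- The supremum over `Δ` must be strictly below `1`, so excluding eigenvalues with `|z| ≥ 1` is
  -- not enough. Compactness extends the strict bound to `|w| < 1 + δ`, uniformly in `Δ`.
  obtain ⟨δ, hδ, hthick⟩ :=
    (isCompact_closedBall (0 : ℂ) 1).exists_thickening_subset_open hSopen hSball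
  rw [thickening_closedBall hδ zero_le_one] at hthick
  let R : NNReal := ⟨(δ + 1)⁻¹, by positivity⟩
  have hR : (R : ℝ≥0∞) < 1 := by
    have : R < 1 := NNReal.coe_lt_coe.mp
      (show (δ + 1)⁻¹ < 1 from inv_lt_one_of_one_lt₀ (by linarith))
    exact_mod_cast this
  refine lt_of_le_of_lt (iSup_le fun Δ => specRadius_le fun z v hv hzv => ?_) hR
  by_contra! hlt
  have hz : (δ + 1)⁻¹ < ‖z‖ := hlt
  have hz0 : 0 < ‖z‖ := lt_trans (by positivity) hz
  have hzne : z ≠ 0 := norm_pos_iff.mp hz0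
  have hwS : z⁻¹ ∈ S := hthick (by
    rw [mem_ball_zero_iff, norm_inv]
    exact inv_lt_of_inv_lt₀ (by positivity) hz)
  have hmode : ∀ i, ε * (α / √2) * (√(lam i) * ‖z‖) < ‖modeValue α β ν (lam i) z‖ := by
    intro i
    have h1 : ε * (α / √2) * (√(lam i) * ‖z⁻¹‖)
      < ‖1 + bCoef α β ν (lam i) * z⁻¹ + cCoef α β ν (lam i) * z⁻¹ ^ 2‖ :=
      Set.mem_iInter.mp hwS i
    have h2 : modeValue α β ν (lam i) z
        = z ^ 2 * (1 + bCoef α β ν (lam i) * z⁻¹ + cCoef α β ν (lam i) * z⁻¹ ^ 2) := by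
      unfold modeValue; field_simp
    rw [h2, norm_mul, norm_pow]
    have h3 := mul_lt_mul_of_pos_left h1 (pow_pos hz0 2)
    refine lt_of_eq_of_lt ?_ h3
    rw [norm_inv]
    field_simp
  obtain ⟨η, hη, rfl⟩ := exists_modes_of_perturbed_eigenvector hU α β ν Δ.1 hv hzv
  have hmod := (perturbed_mulVec_eq_smul_iff hU hdecomp α β ν Δ.1 z η).mp hzv
  have h1 := sum_norm_sq_orthogonal hU (fun i => modeValue α β ν (lam i) z * η i)
  rw [hmod] at h1
  have h2 := sum_norm_sq_mulVec_le Δ.1 (fun i => z * (1 / √2 * √(lam i) * η i : ℂ))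
  have h3 : ‖Δ.1‖ ^ 2 ≤ ε ^ 2 := pow_le_pow_left₀ (norm_nonneg _) Δ.2 2
  have h4 : ∑ i, ‖modeValue α β ν (lam i) z * η i‖ ^ 2
      ≤ ∑ i, (ε * (α / √2) * (√(lam i) * ‖z‖) * ‖η i‖) ^ 2 := by
    rw [← h1]
    have e1 : ∑ i, ‖(-(α : ℂ) • Δ.1 *ᵥ fun i => z * (1 / √2 * √(lam i) * η i : ℂ)) i‖ ^ 2
        = α ^ 2 * ∑ i, ‖(Δ.1 *ᵥ fun i => z * (1 / √2 * √(lam i) * η i : ℂ)) i‖ ^ 2 := by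
      rw [Finset.mul_sum]
      refine Finset.sum_congr rfl fun i _ => ?_
      rw [Pi.smul_apply, smul_eq_mul, norm_mul, norm_neg, Complex.norm_real, mul_pow,
        Real.norm_eq_abs, sq_abs]
    have e2 : ∑ i, (ε * (α / √2) * (√(lam i) * ‖z‖) * ‖η i‖) ^ 2
        = α ^ 2 * (ε ^ 2 * ∑ i, ‖z * (1 / √2 * √(lam i) * η i : ℂ)‖ ^ 2) := by
      rw [Finset.mul_sum, Finset.mul_sum]
      refine Finset.sum_congr rfl fun i _ => ?_
      simp only [norm_mul, norm_div, Complex.norm_real, norm_one,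
        Real.norm_of_nonneg (Real.sqrt_nonneg _)]
      ring
    rw [e1, e2]
    exact mul_le_mul_of_nonneg_left (h2.trans (mul_le_mul_of_nonneg_right h3 (by positivity)))
      (sq_nonneg _)
  -- By `hmode` each nonzero coordinate of `η` makes the left side strictly larger.
  refine absurd h4 (not_le.mpr ?_)
  obtain ⟨k, hk⟩ := Function.ne_iff.mp hη
  refine Finset.sum_lt_sum (fun i _ => ?_) ⟨k, Finset.mem_univ _, ?_⟩
  · rw [norm_mul]
    exact pow_le_pow_left₀ (by positivity)
      (mul_le_mul_of_nonneg_right (hmode i).le (norm_nonneg _)) 2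
  · rw [norm_mul]
    exact pow_lt_pow_left₀ (mul_lt_mul_of_pos_right (hmode k) (norm_pos_iff.mpr hk))
      (by positivity) two_ne_zero

/-- Multiplication by a complex number, realised on the plane of two coordinates. -/
lemma exists_real_matrix_mulVec_eq {j k : Fin d} (hjk : j ≠ k) (κ : ℂ) :
    ∃ R : Matrix (Fin d) (Fin d) ℝ, ‖R‖ ≤ ‖κ‖ ∧
      toC R *ᵥ (Pi.single j 1 + Pi.single k (-Complex.I))
        = κ • (Pi.single j 1 + Pi.single k (-Complex.I) : Fin d → ℂ) := by
  refine ⟨Matrix.single j j κ.re + Matrix.single k k κ.re + Matrix.single k j κ.im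
    + Matrix.single j k (-κ.im), ?_, ?_⟩
  -- The matrix is the rotation-scaling by `κ` on the `(j, k)` plane and zero elsewhere.
  · refine norm_le_of_sum_norm_sq_mulVec_le _ (norm_nonneg _) fun x => ?_
    have h1 : ∀ i, ‖((Matrix.single j j κ.re + Matrix.single k k κ.re + Matrix.single k j κ.im
        + Matrix.single j k (-κ.im)) *ᵥ x) i‖ ^ 2
        = (Pi.single j ((κ.re * x j - κ.im * x k) ^ 2) : Fin d → ℝ) i
          + (Pi.single k ((κ.im * x j + κ.re * x k) ^ 2) : Fin d → ℝ) i := fun i => by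
      simp only [Matrix.add_mulVec, Matrix.single_mulVec_eq, Real.norm_eq_abs, sq_abs]
      by_cases hij : i = j
      · subst hij
        simp [hjk]
        ring
      · by_cases hik : i = k
        · subst hik
          simp [hij]
          ring
        · simp [hij, hik]
    have h2 : x j ^ 2 + x k ^ 2 ≤ ∑ i, ‖x i‖ ^ 2 := by
      simp only [Real.norm_eq_abs, sq_abs]
      rw [← Finset.sum_pair hjk (f := fun i => x i ^ 2)]
      exact Finset.sum_le_sum_of_subset_of_nonneg (Finset.subset_univ _) fun _ _ _ => sq_nonneg _
    simp only [h1, Finset.sum_add_distrib, Finset.sum_pi_single', Finset.mem_univ, if_true]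
    rw [Complex.sq_norm, Complex.normSq_apply]
    calc _ = (κ.re * κ.re + κ.im * κ.im) * (x j ^ 2 + x k ^ 2) := by ring
      _ ≤ _ := mul_le_mul_of_nonneg_left h2
        (add_nonneg (mul_self_nonneg _) (mul_self_nonneg _))
  · have hR : toC (Matrix.single j j κ.re + Matrix.single k k κ.re + Matrix.single k j κ.im
        + Matrix.single j k (-κ.im)) = Matrix.single j j (κ.re : ℂ) + Matrix.single k k (κ.re : ℂ)
          + Matrix.single k j (κ.im : ℂ) + Matrix.single j k (-κ.im : ℂ) := by
      have hs : ∀ (i j : Fin d) (r : ℝ), toC (Matrix.single i j r) = Matrix.single i j (r : ℂ) :=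
        fun i j r => by ext; simp [toC, Matrix.single_apply, apply_ite Complex.ofReal]
      simp only [toC_add, hs, Complex.ofReal_neg]
    rw [hR]
    ext i
    simp only [Matrix.add_mulVec, Matrix.single_mulVec_eq]
    by_cases hij : i = j
    · subst hij
      simp [hjk, hjk.symm]
    · by_cases hik : i = k
      · subst hik
        simp [hij, hjk, Complex.ext_iff]
      · simp [hij, hik]

/-- A double eigenvalue allows an optimal destabilising perturbation to be real. -/
lemma one_le_rhoReal (hU : U ∈ Matrix.orthogonalGroup (Fin d) ℝ)
    (hdecomp : Q = U * Matrix.diagonal lam * Uᵀ) (hα : 0 < α) {j k : Fin d} (hjk : j ≠ k)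
    (hlam : lam j = lam k) (hpos : 0 < lam j) {z : ℂ} (hz : ‖z‖ = 1) :
    1 ≤ rhoReal (stateMatrix α β ν Q) (inputMatrix d α) (outputMatrix U lam)
      (√2 * ‖modeValue α β ν (lam j) z‖ / (α * √(lam j))) := by
  have hz0 : z ≠ 0 := by rintro rfl; simp at hz
  have hsq : 0 < √(lam j) := Real.sqrt_pos.mpr hpos
  -- The scalar for which `Δ = U R` satisfies the perturbed modal equation at `z` on `η = e_j - i
  -- e_k`.
  obtain ⟨κ, hκ⟩ : ∃ κ : ℂ, κ = -(√2 * modeValue α β ν (lam j) z) / (α * √(lam j) * z) := ⟨_, rfl⟩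
  have hκn : ‖κ‖ = √2 * ‖modeValue α β ν (lam j) z‖ / (α * √(lam j)) := by
    rw [hκ]
    simp only [norm_div, norm_neg, norm_mul, Complex.norm_real, hz, mul_one,
      Real.norm_of_nonneg (Real.sqrt_nonneg _), Real.norm_of_nonneg hα.le]
  obtain ⟨R, hRn, hR⟩ := exists_real_matrix_mulVec_eq hjk κ
  set η : Fin d → ℂ := Pi.single j 1 + Pi.single k (-Complex.I) with hη
  have hη0 : η ≠ 0 := fun h0 => by
    have := congrFun h0 j
    simp [hη, hjk] at this
  have hΔn : ‖U * R‖ ≤ √2 * ‖modeValue α β ν (lam j) z‖ / (α * √(lam j)) := by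
    rw [← hκn]
    have : ‖U * R‖ = ‖R‖ := CStarRing.norm_mem_unitary_mul R hU
    rwa [this]
  -- This is where the double eigenvalue enters: `η` lives on coordinates with one common `λ`.
  have hscalar : ∀ f : ℝ → ℂ, (fun i => f (lam i) * η i) = f (lam j) • η := fun f => by
    ext i
    by_cases hij : i = j
    · simp [hij]
    · by_cases hik : i = k
      · simp [hik, hlam]
      · simp [hη, hij, hik]
  have heig := (perturbed_mulVec_eq_smul_iff hU hdecomp α β ν (toC (U * R)) z η).mpr (by
    rw [hscalar (fun l => modeValue α β ν l z)]
    have h1 : (fun i => z * (1 / √2 * √(lam i) * η i : ℂ))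
        = (z * (1 / √2 * √(lam j))) • η := by
      rw [← hscalar (fun l => (z * (1 / √2 * √l) : ℂ))]
      ext i
      ring
    rw [h1, Matrix.mulVec_smul, Matrix.mulVec_smul, toC_mul, ← Matrix.mulVec_mulVec, hR,
      Matrix.mulVec_smul, smul_smul, smul_smul]
    congr 1
    have h2 : (√2 : ℂ) ≠ 0 := by simp
    have h3 : (√(lam j) : ℂ) ≠ 0 := by exact_mod_cast hsq.ne'
    have h4 : (α : ℂ) ≠ 0 := by exact_mod_cast hα.ne'
    rw [hκ]
    field_simp)
  have hle := nnnorm_le_specRadius (elim_modes_ne_zero hU z hη0) heig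
  have hz1 : (‖z‖₊ : ℝ≥0∞) = 1 := by
    have : ‖z‖₊ = 1 := NNReal.eq hz
    simp [this]
  rw [hz1, ← toC_mul, ← toC_mul, ← toC_add] at hle
  exact hle.trans (le_iSup (fun Δ : {Δ : Matrix (Fin d) (Fin d) ℝ // ‖Δ‖ ≤ _} =>
    specRadius (toC (stateMatrix α β ν Q + inputMatrix d α * Δ.1 * outputMatrix U lam)))
    ⟨U * R, hΔn⟩)

lemma norm_transferMatrix (hU : U ∈ Matrix.orthogonalGroup (Fin d) ℝ)
    (hdecomp : Q = U * Matrix.diagonal lam * Uᵀ) {z : ℂ} (hz : ‖z‖ = 1)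
    (hq : ∀ i, modeValue α β ν (lam i) z ≠ 0) :
    ‖transferMatrix (stateMatrix α β ν Q) (inputMatrix d α) (outputMatrix U lam) z‖
      = ‖fun i => α / √2 * (√(lam i) / ‖modeValue α β ν (lam i) z‖)‖ := by
  rw [transferMatrix_eq hU hdecomp hq, CStarRing.norm_mul_mem_unitary _ (toC_mem_unitary hU).2,
    Matrix.l2_opNorm_diagonal]
  simp only [Pi.norm_def]
  congr 2
  ext i
  simp only [coe_nnnorm, norm_div, norm_neg, norm_mul, Complex.norm_real, hz, norm_one, norm_norm]
  ring

end Radius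

end GMM

/-! ### Identification of the four quantities. -/

theorem mainTheorem6 (d : ℕ) (hd : 4 ≤ d) (μ L α β ν : ℝ)
    (hα : 0 < α) (hβ : 0 ≤ β) (hν : 0 ≤ ν)
    -- the quadratic objective
    (Q : Matrix (Fin d) (Fin d) ℝ) (hQ : Q.PosDef) (p : Fin d → ℝ) (r : ℝ)
    (f : EuclideanSpace ℝ (Fin d) → ℝ) (hf : GMM.IsStronglyConvexSmooth μ L f)
    (hfQ : f = GMM.quadratic Q p r)
    -- an eigenvalue decomposition of `Q`, with the eigenvalues in increasing order
    (U : Matrix (Fin d) (Fin d) ℝ) (hU : U ∈ Matrix.orthogonalGroup (Fin d) ℝ)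
    (lam : Fin d → ℝ) (hlam : Monotone lam) (hdecomp : Q = U * Matrix.diagonal lam * Uᵀ)
    (hμ : lam ⟨0, by omega⟩ = μ) (hL : lam ⟨d - 1, by omega⟩ = L)
    -- the two smallest eigenvalues coincide, and so do the two largest
    (hμ' : lam ⟨1, by omega⟩ = μ) (hL' : lam ⟨d - 2, by omega⟩ = L)
    -- the noiseless iteration is convergent
    (hρ : GMM.specRadius (GMM.toC (GMM.stateMatrix α β ν Q)) < 1) :
    -- the maxima that define `H∞` and `H∞^{lb}` are attained, and positive
    (∃ z ∈ Metric.sphere (0 : ℂ) 1,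
      IsMaxOn (fun z : ℂ => ‖GMM.transferMatrix (GMM.stateMatrix α β ν Q) (GMM.inputMatrix d α)
        (GMM.outputMatrix U lam) z‖) (Metric.sphere 0 1) z) ∧
    (∃ ω ∈ Set.Icc 0 (2 * Real.pi),
      IsMaxOn (GMM.lowerBoundFun α β ν μ (lam ⟨1, by omega⟩) (lam ⟨d - 2, by omega⟩) L)
        (Set.Icc 0 (2 * Real.pi)) ω) ∧
    0 < GMM.hInf (GMM.stateMatrix α β ν Q) (GMM.inputMatrix d α) (GMM.outputMatrix U lam) ∧
    0 < GMM.hInfLB α β ν μ (lam ⟨1, by omega⟩) (lam ⟨d - 2, by omega⟩) L ∧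
    -- the four quantities coincide
    GMM.realStabilityRadius (GMM.stateMatrix α β ν Q) (GMM.inputMatrix d α)
        (GMM.outputMatrix U lam) =
      GMM.complexStabilityRadius (GMM.stateMatrix α β ν Q) (GMM.inputMatrix d α)
        (GMM.outputMatrix U lam) ∧
    GMM.complexStabilityRadius (GMM.stateMatrix α β ν Q) (GMM.inputMatrix d α)
        (GMM.outputMatrix U lam) =
      (GMM.hInfLB α β ν μ (lam ⟨1, by omega⟩) (lam ⟨d - 2, by omega⟩) L)⁻¹ ∧
    (GMM.hInfLB α β ν μ (lam ⟨1, by omega⟩) (lam ⟨d - 2, by omega⟩) L)⁻¹ =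
      (GMM.hInf (GMM.stateMatrix α β ν Q) (GMM.inputMatrix d α) (GMM.outputMatrix U lam))⁻¹ := by
  have hμ0 : 0 < μ := hf.1
  have hlμ : ∀ i, μ ≤ lam i := fun i => hμ ▸ hlam (Fin.mk_le_of_le_val (Nat.zero_le _))
  have hlL : ∀ i, lam i ≤ L := fun i =>
    hL ▸ hlam (Fin.le_def.mpr (by have := i.2; simp only; omega))
  have hstab : ∀ i, ∀ z : ℂ, GMM.modeValue α β ν (lam i) z = 0 → ‖z‖ < 1 := fun i z hz =>
    GMM.norm_lt_one_of_modeValue_eq_zero hU hdecomp hρ i hz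
  have hne : ∀ i, ∀ z : ℂ, ‖z‖ = 1 → GMM.modeValue α β ν (lam i) z ≠ 0 := fun i z hz h0 =>
    (hstab i z h0).ne hz
  have hμL : μ ≤ L := hL ▸ hlμ _
  have hL0 : 0 < L := hμ0.trans_le hμL
  rw [hμ', hL']
  have hneμ : ∀ z : ℂ, ‖z‖ = 1 → GMM.modeValue α β ν μ z ≠ 0 := hμ ▸ hne _
  have hneL : ∀ z : ℂ, ‖z‖ = 1 → GMM.modeValue α β ν L z ≠ 0 := hL ▸ hne _
  have hexp : ∀ ω : ℝ, ‖Complex.exp (Complex.I * ω)‖ = 1 := fun ω => by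
    rw [mul_comm, Complex.norm_exp_ofReal_mul_I]
  have hlb : ∀ ω, GMM.lowerBoundFun α β ν μ μ L L ω
      = max (GMM.gainTerm α β ν ω μ) (GMM.gainTerm α β ν ω L) := fun ω => min_self _
  have hcont : Continuous (GMM.lowerBoundFun α β ν μ μ L L) := by
    rw [funext hlb]
    simp only [GMM.gainTerm_eq]
    have hc : ∀ l : ℝ, (∀ z : ℂ, ‖z‖ = 1 → GMM.modeValue α β ν l z ≠ 0) →
        Continuous fun ω : ℝ => √l / ‖GMM.modeValue α β ν l (Complex.exp (Complex.I * ω))‖ :=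
      fun l hl => continuous_const.div ((GMM.continuous_modeValue α β ν l).comp
        (by fun_prop)).norm fun ω => norm_ne_zero_iff.mpr (hl _ (hexp ω))
    exact (hc μ hneμ).max (hc L hneL)
  obtain ⟨ω, hω, hmax⟩ := isCompact_Icc.exists_isMaxOn
    (Set.nonempty_Icc.mpr (by positivity : (0 : ℝ) ≤ 2 * Real.pi)) hcont.continuousOn
  obtain ⟨M, hM⟩ : ∃ M, M = GMM.lowerBoundFun α β ν μ μ L L ω := ⟨_, rfl⟩
  have hM0 : 0 < M := by
    rw [hM, hlb, GMM.gainTerm_eq]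
    exact lt_max_of_lt_left
      (div_pos (Real.sqrt_pos.mpr hμ0) (norm_pos_iff.mpr (hneμ _ (hexp ω))))
  have hLB : GMM.hInfLB α β ν μ μ L L = α / √2 * M := by
    have hgreat : IsGreatest (GMM.lowerBoundFun α β ν μ μ L L '' Set.Icc 0 (2 * Real.pi)) M :=
      ⟨⟨ω, hω, hM.symm⟩, by rintro _ ⟨ω', hω', rfl⟩; exact hM ▸ isMaxOn_iff.mp hmax ω' hω'⟩
    rw [GMM.hInfLB, hgreat.csSup_eq]
  have hends : ∀ z : ℂ, ‖z‖ = 1 → √μ ≤ M * ‖GMM.modeValue α β ν μ z‖ ∧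
      √L ≤ M * ‖GMM.modeValue α β ν L z‖ := fun z hz => by
    obtain ⟨ω', hω', rfl⟩ := GMM.exists_exp_eq_of_norm_eq_one hz
    have h1 := isMaxOn_iff.mp hmax ω' hω'
    rw [← hM, hlb, max_le_iff, GMM.gainTerm_eq, GMM.gainTerm_eq,
      div_le_iff₀ (norm_pos_iff.mpr (hneμ _ hz)), div_le_iff₀ (norm_pos_iff.mpr (hneL _ hz))] at h1
    exact h1
  have hgain : ∀ i, ∀ z : ℂ, ‖z‖ = 1 → √(lam i) ≤ M * ‖GMM.modeValue α β ν (lam i) z‖ :=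
    fun i z hz => GMM.sqrt_le_mul_norm_modeValue hα hν hμ0 ⟨hlμ i, hlL i⟩ hM0
      (hμ ▸ hstab _) (hL ▸ hstab _) (fun z hz => (hends z hz).1) (fun z hz => (hends z hz).2) hz
  obtain ⟨z, hz⟩ : ∃ z : ℂ, z = Complex.exp (Complex.I * ω) := ⟨_, rfl⟩
  have hz1 : ‖z‖ = 1 := hz ▸ hexp ω
  -- Whichever of `μ`, `L` attains the maximal gain, it supplies two distinct indices.
  obtain ⟨j, k, hjk, hjklam, hj⟩ : ∃ j k : Fin d, j ≠ k ∧ lam j = lam k ∧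
      M = √(lam j) / ‖GMM.modeValue α β ν (lam j) z‖ := by
    rcases max_choice (GMM.gainTerm α β ν ω μ) (GMM.gainTerm α β ν ω L) with h | h
    · refine ⟨⟨0, by omega⟩, ⟨1, by omega⟩, by simp, hμ.trans hμ'.symm, ?_⟩
      rw [hM, hlb, h, GMM.gainTerm_eq, hμ, hz]
    · refine ⟨⟨d - 1, by omega⟩, ⟨d - 2, by omega⟩, by simp only [ne_eq, Fin.mk.injEq]; omega,
        hL.trans hL'.symm, ?_⟩
      rw [hM, hlb, h, GMM.gainTerm_eq, hL, hz]
  have hlj : 0 < lam j := hμ0.trans_le (hlμ j)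
  have hK : 0 < α / √2 := by positivity
  have hGle : ∀ z' : ℂ, ‖z'‖ = 1 → ‖GMM.transferMatrix (GMM.stateMatrix α β ν Q)
      (GMM.inputMatrix d α) (GMM.outputMatrix U lam) z'‖ ≤ α / √2 * M := fun z' hz' => by
    rw [GMM.norm_transferMatrix hU hdecomp hz' fun i => hne i z' hz',
      pi_norm_le_iff_of_nonneg (by positivity)]
    intro i
    rw [Real.norm_of_nonneg (by positivity)]
    exact mul_le_mul_of_nonneg_left
      ((div_le_iff₀ (norm_pos_iff.mpr (hne i z' hz'))).mpr (hgain i z' hz')) hK.le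
  have hGz : ‖GMM.transferMatrix (GMM.stateMatrix α β ν Q)
      (GMM.inputMatrix d α) (GMM.outputMatrix U lam) z‖ = α / √2 * M := by
    refine le_antisymm (hGle z hz1) ?_
    rw [GMM.norm_transferMatrix hU hdecomp hz1 fun i => hne i z hz1, hj]
    refine le_trans (le_abs_self _) ?_
    exact norm_le_pi_norm
      (fun i => α / √2 * (√(lam i) / ‖GMM.modeValue α β ν (lam i) z‖)) j
  have hzmem : z ∈ Metric.sphere (0 : ℂ) 1 := by simpa using hz1
  have hH : GMM.hInf (GMM.stateMatrix α β ν Q) (GMM.inputMatrix d α) (GMM.outputMatrix U lam)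
      = α / √2 * M :=
    IsGreatest.csSup_eq ⟨⟨z, hzmem, hGz⟩, by
      rintro _ ⟨z', hz', rfl⟩
      exact hGle z' (by simpa using hz')⟩
  have hinv : (α / √2 * M)⁻¹ = √2 * ‖GMM.modeValue α β ν (lam j) z‖ / (α * √(lam j)) := by
    rw [hj]
    have := norm_ne_zero_iff.mpr (hne j z hz1)
    have := (Real.sqrt_pos.mpr hlj).ne'
    field_simp
  have hreal : 1 ≤ GMM.rhoReal (GMM.stateMatrix α β ν Q) (GMM.inputMatrix d α)
      (GMM.outputMatrix U lam) (α / √2 * M)⁻¹ := by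
    rw [hinv]
    exact GMM.one_le_rhoReal hU hdecomp hα hjk hjklam hlj hz1
  -- With `hreal`, this makes `(α/√2 * M)⁻¹` the least element of both sets defining the radii.
  have hlow : ∀ ε : ℝ, 0 < ε → 1 ≤ GMM.rhoComplex (GMM.stateMatrix α β ν Q)
      (GMM.inputMatrix d α) (GMM.outputMatrix U lam) ε → (α / √2 * M)⁻¹ ≤ ε := by
    intro ε hε h1
    by_contra! hlt
    refine absurd h1 (not_le.mpr (GMM.rhoComplex_lt_one hU hdecomp hα hε.le hstab hgain ?_))
    rwa [lt_inv_comm₀ hε (by positivity), ← one_div, lt_div_iff₀ hε, mul_comm] at hlt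
  have hrR : GMM.realStabilityRadius (GMM.stateMatrix α β ν Q) (GMM.inputMatrix d α)
      (GMM.outputMatrix U lam) = (α / √2 * M)⁻¹ :=
    IsLeast.csInf_eq ⟨⟨by positivity, hreal⟩, fun ε hε =>
      hlow ε hε.1 (hε.2.trans (GMM.rhoReal_le_rhoComplex _ _ _ _))⟩
  have hrC : GMM.complexStabilityRadius (GMM.stateMatrix α β ν Q) (GMM.inputMatrix d α)
      (GMM.outputMatrix U lam) = (α / √2 * M)⁻¹ :=
    IsLeast.csInf_eq ⟨⟨by positivity, hreal.trans (GMM.rhoReal_le_rhoComplex _ _ _ _)⟩,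
      fun ε hε => hlow ε hε.1 hε.2⟩
  refine ⟨⟨z, hzmem, isMaxOn_iff.mpr fun z' hz' => ?_⟩, ⟨ω, hω, hmax⟩, ?_, ?_, ?_, ?_, ?_⟩
  · rw [hGz]
    exact hGle z' (by simpa using hz')
  · rw [hH]; positivity
  · rw [hLB]; positivity
  · rw [hrR, hrC]
  · rw [hrC, hLB]
  · rw [hLB, hH]
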